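/- Let $X=(X_t)_{t\ge 0}$ be a scalar Lévy process on a probability space ($X_0=0$ a.s., independent and stationary increments, a.s. càdlàg paths) with characteristic triplet $(m,\sigma,\nu)$, i.e. $$\mathbb{E}[e^{iuX_t}]=\exp\Big(t\Big(imu-\tfrac12\sigma^2u^2+\int_{\mathbb{R}}\big(e^{iuz}-1-iuz\,1_{|z|<1}\big)\,\nu(dz)\Big)\Big),\qquad t\ge 0,\ u\in\mathbb{R},$$ where $m,\sigma\in\mathbb{R}$, $\nu(\{0\})=0$ and $\int\min(1,z^2)\,\nu(dz)<\infty$. Assume that $\int_{|z|>1}e^{2z}\,\nu(dz)<\infty$. Let $S_0>0$, $T>0$, and put $$\overline S=\frac{S_0}{T}\int_0^T e^{X_t}\,dt,\qquad \widehat S^{(n)}=\frac{S_0}{T}\sum_{j=0}^{n-1}\tfrac12 h\big(e^{X_{jh}}+e^{X_{(j+1)h}}\big),\quad h=T/n,\ n\ge 1 .$$ Then there is a constant $C$, depending only on the process $X$ and on $S_0$ and $T$, such that: 1. for every $n\ge 1$, the random variable $\widehat S^{(n)}-\overline S$ is square integrable and $\mathbb{E}\big[(\widehat S^{(n)}-\overline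 S)^2\big]\le C h^2$ with $h=T/n$; 2. for every $L\ge 0$, every payoff $P:\mathbb{R}\to\mathbb{R}$ that is Lipschitz with constant $L$, and every $n\ge 1$, the random variables $P(\overline S)$ and $P(\widehat S^{(n)})$ are integrable and $\big|\mathbb{E}[P(\widehat S^{(n)})-P(\overline S)]\big|\le C L h$ with $h=T/n$; 3. for every such $L$ and $P$, every integer $M\ge 2$ and every level $\ell\ge 1$, with $\widehat P_\ell=P(\widehat S^{(M^\ell)})$ and $h_\ell=M^{-\ell}T$, the multilevel correction $\widehat P_\ell-\widehat P_{\ell-1}$ is square integrable and $\mathbb{V}[\widehat P_\ell-\widehat P_{\ell-1}]\le C L^2M^2h_\ell^2$. That is, the mean-square error is $O(h^2)$, the weak error is $O(h)$ and the multilevel variance is $O(h_\ell^2)$. -/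

import Mathlib

open MeasureTheory ProbabilityTheory Filter Topology
open scoped NNReal ENNReal

noncomputable section

/-- A function on `[0, ∞)` is càdlàg: right-continuous with (finite) left limits. -/
def IsCadlagPath (x : ℝ≥0 → ℝ) : Prop :=
  ∀ t : ℝ≥0, ContinuousWithinAt x (Set.Ici t) t ∧ ∃ l : ℝ, Tendsto x (𝓝[<] t) (𝓝 l)

/-- A scalar Lévy process: it starts at `0`, has independent and stationary increments,
and almost every path is càdlàg. -/
structure IsLevyProcess {Ω : Type*} [MeasurableSpace Ω] (X : ℝ≥0 → Ω → ℝ) (P : Measure Ω) :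
    Prop where
  measurable : ∀ t, Measurable (X t)
  start_zero : ∀ᵐ ω ∂P, X 0 ω = 0
  indep_increments : HasIndepIncrements X P
  stationary_increments : ∀ s t : ℝ≥0, IdentDistrib (fun ω => X (s + t) ω - X s ω) (X t) P P
  cadlag : ∀ᵐ ω ∂P, IsCadlagPath (fun t => X t ω)

/-- A Lévy measure on `ℝ`: no atom at `0`, and `∫ min(1, z²) ν(dz) < ∞`. -/
structure IsLevyMeasure (ν : Measure ℝ) : Prop where
  zero_singleton : ν {0} = 0
  lintegral_lt_top : ∫⁻ z, ENNReal.ofReal (min 1 (z ^ 2)) ∂ν < ∞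

/-- The characteristic exponent of the triplet `(m, σ, ν)`, with truncation at `|z| < 1`:
`ψ(u) = i m u - σ² u² / 2 + ∫ (e^{iuz} - 1 - i u z 1_{|z| < 1}) ν(dz)`. -/
def levyExponent (m σ : ℝ) (ν : Measure ℝ) (u : ℝ) : ℂ :=
  Complex.I * m * u - (σ : ℂ) ^ 2 * (u : ℂ) ^ 2 / 2 +
    ∫ z : ℝ, (Complex.exp (Complex.I * u * z) - 1 -
      Set.indicator {y : ℝ | |y| < 1} (fun y : ℝ => Complex.I * u * (y : ℂ)) z) ∂ν

/-- `X` is a Lévy process with triplet `(m, σ, ν)`: drift `m`, diffusion coefficient `σ`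
and Lévy measure `ν`, i.e. `E[e^{iuX_t}] = e^{t ψ(u)}`. -/
structure IsLevyProcessWithTriplet {Ω : Type*} [MeasurableSpace Ω] (X : ℝ≥0 → Ω → ℝ)
    (P : Measure Ω) (m σ : ℝ) (ν : Measure ℝ) : Prop where
  isLevyProcess : IsLevyProcess X P
  isLevyMeasure : IsLevyMeasure ν
  charFun_eq : ∀ (t : ℝ≥0) (u : ℝ),
    charFun (P.map (X t)) u = Complex.exp ((t : ℂ) * levyExponent m σ ν u)

/-- The continuously monitored arithmetic average `S₀ T⁻¹ ∫₀ᵀ exp(X_t) dt`. -/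
def asianAverage {Ω : Type*} (X : ℝ≥0 → Ω → ℝ) (S₀ T : ℝ) (ω : Ω) : ℝ :=
  S₀ * T⁻¹ * ∫ t in (0 : ℝ)..T, Real.exp (X t.toNNReal ω)

/-- The trapezoidal approximation of the average with `n` uniform steps of size `h = T / n`:
`S₀ T⁻¹ ∑_{j<n} (h/2) (exp(X_{jh}) + exp(X_{(j+1)h}))`. -/
def trapezoidalAverage {Ω : Type*} (X : ℝ≥0 → Ω → ℝ) (S₀ T : ℝ) (n : ℕ) (ω : Ω) : ℝ :=
  S₀ * T⁻¹ * ∑ j ∈ Finset.range n, 1 / 2 * (T / n) *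
    (Real.exp (X ((j : ℝ) * (T / n)).toNNReal ω) +
      Real.exp (X (((j : ℝ) + 1) * (T / n)).toNNReal ω))

end

/-! The trapezoidal sum differs from the right-endpoint Riemann sum by `h/2` times `e^{X_0} -
e^{X_T}`, which is of order `h` in `L²`. It remains to estimate the Riemann sum error, a sum of
contributions from `n` blocks of length `h`. An increment of `e^X` over a block has second moment
only of order `h`, but increments over separate blocks have product expectation of order `h²`. The
`n` diagonal terms and the `n²` off-diagonal ones, weighted by `h²`, then both contribute `O(h²)`.

The correlation bound comes from a factorisation. With `φ(t) = E e^{X_t}`, `ψ(t) = E e^{2X_t}` and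
`r = ψ/φ`, independence and stationarity give `E[e^{X_s} e^{X_t}] = r(s) φ(t)` for `s ≤ t`. The
product expectation of two successive increments is therefore `(r(s') - r(s)) (φ(t') - φ(t))`, and
only Lipschitz bounds for `r` and `φ` are needed (`IsLevyProcess.exists_increment_bounds`). Both are
positive and multiplicative in time, so a bound `ψ(t) ≤ e^{ct}` yields them without an exact moment
formula.

That bound (`exists_lintegral_exp_le`) is read off the characteristic function: the law is a weak
limit of Gaussian laws convolved with compound Poisson laws, whose exponential moments are explicit,
and exponential moments are lower semicontinuous under weak limits.

Riemann sums are compared with their refinements (`integral_sq_rightSum_sub_le`), uniformly in the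
refinement. Right continuity of paths makes the refinements converge almost surely to the integral,
and Fatou transfers the bound. Lipschitz payoffs inherit the estimate. -/

/-! ### Compound Poisson laws: exponential moments and characteristic functions. -/

/-- Iterated convolution powers of a measure on `ℝ`. -/
noncomputable def convPow (ρ : Measure ℝ) : ℕ → Measure ℝ
  | 0 => Measure.dirac 0
  | k + 1 => Measure.conv (convPow ρ k) ρ

instance isFiniteMeasure_convPow (ρ : Measure ℝ) [IsFiniteMeasure ρ] (k : ℕ) :
    IsFiniteMeasure (convPow ρ k) := by
  induction k with
  | zero => unfold convPow; infer_instance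
  | succ k ih => unfold convPow; infer_instance

/-- The compound Poisson law with finite jump intensity measure `ρ`. -/
noncomputable def compoundPoisson (ρ : Measure ℝ) : Measure ℝ :=
  ENNReal.ofReal (Real.exp (-ρ.real Set.univ)) •
    Measure.sum fun k => ENNReal.ofReal ((k.factorial : ℝ)⁻¹) • convPow ρ k

lemma lintegral_convPow (ρ : Measure ℝ) [IsFiniteMeasure ρ] {f : ℝ → ℝ≥0∞} (hf : Measurable f)
    (h0 : f 0 = 1) (hadd : ∀ x y, f (x + y) = f x * f y) (k : ℕ) :
    ∫⁻ x, f x ∂(convPow ρ k) = (∫⁻ x, f x ∂ρ) ^ k := by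
  induction k with
  | zero => simp [convPow, lintegral_dirac' _ hf, h0]
  | succ k ih =>
    rw [convPow, Measure.lintegral_conv hf]
    simp_rw [hadd]
    rw [lintegral_lintegral_mul hf.aemeasurable hf.aemeasurable, ih, pow_succ]

/-- A multiplicative `f` turns convolution powers into powers, so the Poisson mixture sums to an
exponential series. The case `f = 1` gives total mass one, and `f = e^{θ·}` gives the exponential
moment. -/
lemma lintegral_compoundPoisson (ρ : Measure ℝ) [IsFiniteMeasure ρ] {f : ℝ → ℝ≥0∞}
    (hf : Measurable f) (h0 : f 0 = 1) (hadd : ∀ x y, f (x + y) = f x * f y)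
    (hfin : ∫⁻ x, f x ∂ρ ≠ ∞) :
    ∫⁻ x, f x ∂(compoundPoisson ρ) =
      ENNReal.ofReal (Real.exp ((∫⁻ x, f x ∂ρ).toReal - ρ.real Set.univ)) := by
  set a := (∫⁻ x, f x ∂ρ).toReal with ha
  have ha0 : 0 ≤ a := ENNReal.toReal_nonneg
  have haI : ∫⁻ x, f x ∂ρ = ENNReal.ofReal a := (ENNReal.ofReal_toReal hfin).symm
  have hs : HasSum (fun k : ℕ => a ^ k / (k.factorial : ℝ)) (Real.exp a) := by
    rw [Real.exp_eq_exp_ℝ]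
    exact NormedSpace.expSeries_div_hasSum_exp a
  have hterm (k : ℕ) : ∫⁻ x, f x ∂(ENNReal.ofReal ((k.factorial : ℝ)⁻¹) • convPow ρ k) =
      ENNReal.ofReal (a ^ k / (k.factorial : ℝ)) := by
    rw [lintegral_smul_measure, lintegral_convPow ρ hf h0 hadd, haI, smul_eq_mul,
      ← ENNReal.ofReal_pow ha0, ← ENNReal.ofReal_mul (by positivity)]
    congr 1
    field_simp
  rw [compoundPoisson, lintegral_smul_measure, lintegral_sum_measure]
  simp_rw [hterm]
  rw [← ENNReal.ofReal_tsum_of_nonneg (fun k => by positivity) hs.summable, hs.tsum_eq,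
    smul_eq_mul, ← ENNReal.ofReal_mul (by positivity), ← Real.exp_add]
  congr 2
  ring

instance isProbabilityMeasure_compoundPoisson (ρ : Measure ℝ) [IsFiniteMeasure ρ] :
    IsProbabilityMeasure (compoundPoisson ρ) := by
  constructor
  rw [← lintegral_one, lintegral_compoundPoisson ρ measurable_const rfl (by simp) (by simp)]
  simp [Measure.real]

lemma charFun_convPow (ρ : Measure ℝ) [IsFiniteMeasure ρ] (u : ℝ) (k : ℕ) :
    charFun (convPow ρ k) u = charFun ρ u ^ k := by
  induction k with
  | zero => simp [convPow, charFun_dirac]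
  | succ k ih => rw [convPow, charFun_conv, ih, pow_succ]

lemma charFun_compoundPoisson (ρ : Measure ℝ) [IsFiniteMeasure ρ] (u : ℝ) :
    charFun (compoundPoisson ρ) u = Complex.exp (charFun ρ u - ρ.real Set.univ) := by
  have hint : Integrable (fun x : ℝ => Complex.exp (u * x * Complex.I)) (compoundPoisson ρ) := by
    refine Integrable.mono' (integrable_const (1 : ℝ)) (by fun_prop) (ae_of_all _ fun x => ?_)
    rw [← Complex.ofReal_mul, Complex.norm_exp_ofReal_mul_I]
  have hpos : ENNReal.ofReal (Real.exp (-ρ.real Set.univ)) ≠ 0 := by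
    simp [Real.exp_pos]
  have hint' : Integrable (fun x : ℝ => Complex.exp (u * x * Complex.I))
      (Measure.sum fun k => ENNReal.ofReal ((k.factorial : ℝ)⁻¹) • convPow ρ k) :=
    (integrable_smul_measure hpos ENNReal.ofReal_ne_top).1 hint
  have hs := hasSum_integral_measure hint'
  have hterm (k : ℕ) : ∫ x : ℝ, Complex.exp (u * x * Complex.I)
      ∂(ENNReal.ofReal ((k.factorial : ℝ)⁻¹) • convPow ρ k) =
      charFun ρ u ^ k / (k.factorial : ℂ) := by
    rw [integral_smul_measure, ← charFun_apply_real, charFun_convPow,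
      ENNReal.toReal_ofReal (by positivity), Complex.real_smul]
    push_cast
    field_simp
  simp_rw [hterm] at hs
  have hs' : HasSum (fun k : ℕ => charFun ρ u ^ k / (k.factorial : ℂ))
      (Complex.exp (charFun ρ u)) := by
    rw [Complex.exp_eq_exp_ℂ]
    exact NormedSpace.expSeries_div_hasSum_exp _
  rw [charFun_apply_real, compoundPoisson, integral_smul_measure, hs.unique hs',
    ENNReal.toReal_ofReal (by positivity), Complex.real_smul, sub_eq_add_neg, Complex.exp_add]
  push_cast
  ring

/-! ### Integrability of the compensated exponential against a Lévy measure. -/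

/-- The compensated exponential `e^{wz} - 1 - w z 1_{|z| < 1}`. -/
noncomputable def compensatedExp (w : ℂ) (z : ℝ) : ℂ :=
  Complex.exp (w * z) - 1 - Set.indicator {y : ℝ | |y| < 1} (fun y : ℝ => w * (y : ℂ)) z

lemma measurable_truncated_mul (w : ℂ) :
    Measurable (Set.indicator {y : ℝ | |y| < 1} (fun y : ℝ => w * (y : ℂ))) :=
  Measurable.indicator (by fun_prop) (measurableSet_lt (by fun_prop) (by fun_prop))

lemma measurable_compensatedExp (w : ℂ) : Measurable (compensatedExp w) := by
  have := measurable_truncated_mul w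
  unfold compensatedExp
  fun_prop

/-- Inside the unit ball the compensator removes the linear Taylor term, leaving `O(z²)`; outside,
the triangle inequality suffices. The points `|z| = 1` are separate because both indicators vanish
there. -/
lemma norm_compensatedExp_le (w : ℂ) (z : ℝ) :
    ‖compensatedExp w z‖ ≤ (‖w‖ ^ 2 * Real.exp ‖w‖ + Real.exp ‖w‖ + 1) * min 1 (z ^ 2) +
      Set.indicator {y : ℝ | 1 < |y|} (fun y => Real.exp (w.re * y)) z := by
  have hE : 0 < Real.exp ‖w‖ := Real.exp_pos _
  have hre : ‖Complex.exp (w * z)‖ = Real.exp (w.re * z) := by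
    rw [Complex.norm_exp]; simp
  have hW : 0 ≤ ‖w‖ ^ 2 * Real.exp ‖w‖ := by positivity
  rcases lt_trichotomy |z| 1 with h | h | h
  · have hz : z ^ 2 ≤ 1 := by rw [← sq_abs]; nlinarith [abs_nonneg z]
    have key := Complex.norm_exp_sub_sum_le_norm_mul_exp (w * z) 2
    have hn : ‖w * (z : ℂ)‖ = ‖w‖ * |z| := by simp
    have hle : Real.exp ‖w * (z : ℂ)‖ ≤ Real.exp ‖w‖ := by
      rw [hn]; exact Real.exp_le_exp.2 (by nlinarith [norm_nonneg w])
    have h1 : compensatedExp w z = Complex.exp (w * z) -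
        ∑ m ∈ Finset.range 2, (w * (z : ℂ)) ^ m / (m.factorial : ℂ) := by
      simp [compensatedExp, Finset.sum_range_succ, h]; ring
    have h2 : z ∉ {y : ℝ | 1 < |y|} := by simp [h.le]
    rw [h1, Set.indicator_of_notMem h2, min_eq_right hz, add_zero]
    refine key.trans ?_
    calc ‖w * (z : ℂ)‖ ^ 2 * Real.exp ‖w * (z : ℂ)‖
        ≤ ‖w * (z : ℂ)‖ ^ 2 * Real.exp ‖w‖ := by gcongr
      _ = ‖w‖ ^ 2 * Real.exp ‖w‖ * z ^ 2 := by rw [hn, mul_pow, sq_abs]; ring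
      _ ≤ _ := by
        have := sq_nonneg z
        gcongr
        linarith
  · have hz : z ^ 2 = 1 := by rw [← sq_abs, h]; norm_num
    have h1 : compensatedExp w z = Complex.exp (w * z) - 1 := by
      simp [compensatedExp, h]
    have h2 : z ∉ {y : ℝ | 1 < |y|} := by simp [h]
    rw [h1, Set.indicator_of_notMem h2, hz, min_self, add_zero, mul_one]
    refine (norm_sub_le _ _).trans ?_
    have : Real.exp (w.re * z) ≤ Real.exp ‖w‖ := by
      refine Real.exp_le_exp.2 ?_
      calc w.re * z ≤ |w.re * z| := le_abs_self _
        _ = |w.re| := by rw [abs_mul, h, mul_one]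
        _ ≤ ‖w‖ := Complex.abs_re_le_norm w
    rw [hre, norm_one]
    linarith
  · have hz : 1 ≤ z ^ 2 := by rw [← sq_abs]; nlinarith
    have h1 : compensatedExp w z = Complex.exp (w * z) - 1 := by
      simp [compensatedExp, h.le]
    have h2 : z ∈ {y : ℝ | 1 < |y|} := h
    rw [h1, Set.indicator_of_mem h2, min_eq_left hz, mul_one]
    refine (norm_sub_le _ _).trans ?_
    rw [hre, norm_one]
    linarith

lemma IsLevyMeasure.integrable_min {ν : Measure ℝ} (hν : IsLevyMeasure ν) :
    Integrable (fun z : ℝ => min 1 (z ^ 2)) ν := by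
  refine ⟨by fun_prop, ?_⟩
  rw [hasFiniteIntegral_iff_ofReal (ae_of_all _ fun z => by positivity)]
  exact hν.lintegral_lt_top

lemma IsLevyMeasure.integrable_compensatedExp {ν : Measure ℝ} (hν : IsLevyMeasure ν) {w : ℂ}
    (hw : IntegrableOn (fun z : ℝ => Real.exp (w.re * z)) {z : ℝ | 1 < |z|} ν) :
    Integrable (compensatedExp w) ν := by
  have hm : MeasurableSet {z : ℝ | 1 < |z|} := measurableSet_lt (by fun_prop) (by fun_prop)
  exact Integrable.mono' ((hν.integrable_min.const_mul _).add ((integrable_indicator_iff hm).2 hw))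
    (measurable_compensatedExp w).aestronglyMeasurable
    (ae_of_all _ fun z => norm_compensatedExp_le w z)

/-! ### Truncation of small jumps. -/

/-- The jumps of size larger than `1 / (k + 1)`. -/
def largeJumps (k : ℕ) : Set ℝ := {z : ℝ | 1 / ((k : ℝ) + 1) < |z|}

lemma measurableSet_largeJumps (k : ℕ) : MeasurableSet (largeJumps k) :=
  measurableSet_lt (by fun_prop) (by fun_prop)

lemma monotone_largeJumps : Monotone largeJumps := by
  intro i j hij z hz
  simp only [largeJumps, Set.mem_ofPred_eq] at hz ⊢
  exact (Nat.one_div_le_one_div hij).trans_lt hz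

lemma iUnion_largeJumps : ⋃ k, largeJumps k = {0}ᶜ := by
  ext z
  simp only [largeJumps, Set.mem_iUnion, Set.mem_ofPred_eq, Set.mem_compl_iff,
    Set.mem_singleton_iff]
  refine ⟨?_, fun h => exists_nat_one_div_lt (abs_pos.2 h)⟩
  rintro ⟨k, hk⟩ rfl
  rw [abs_zero] at hk
  exact absurd hk (by simp only [not_lt]; positivity)

lemma IsLevyMeasure.measure_largeJumps_lt_top {ν : Measure ℝ} (hν : IsLevyMeasure ν) (k : ℕ) :
    ν (largeJumps k) < ∞ := by
  have hc : (0 : ℝ) < (1 / ((k : ℝ) + 1)) ^ 2 := by positivity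
  refine lt_of_le_of_lt (measure_mono fun z hz => ?_)
    (hν.integrable_min.measure_ge_lt_top hc)
  have hz' : 1 / ((k : ℝ) + 1) < |z| := hz
  have h1 : 1 / ((k : ℝ) + 1) ≤ 1 := by
    rw [div_le_one (by positivity)]; linarith [(Nat.cast_nonneg k : (0 : ℝ) ≤ k)]
  have h0 : 0 ≤ 1 / ((k : ℝ) + 1) := by positivity
  simp only [Set.mem_ofPred_eq, le_min_iff]
  refine ⟨pow_le_one₀ h0 h1, ?_⟩
  rw [← sq_abs z]
  gcongr

/-- The truncation sets exhaust everything except the origin, which carries no mass. -/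
lemma IsLevyMeasure.tendsto_setIntegral_largeJumps {ν : Measure ℝ} (hν : IsLevyMeasure ν)
    {f : ℝ → ℂ} (hf : Integrable f ν) :
    Tendsto (fun k => ∫ z in largeJumps k, f z ∂ν) atTop (𝓝 (∫ z, f z ∂ν)) := by
  have h := tendsto_setIntegral_of_monotone measurableSet_largeJumps monotone_largeJumps
    (μ := ν) (f := f) hf.integrableOn
  have h0 : ({0}ᶜ : Set ℝ) =ᵐ[ν] Set.univ := by
    rw [ae_eq_univ, compl_compl]; exact hν.zero_singleton
  rwa [iUnion_largeJumps, setIntegral_congr_set h0, setIntegral_univ] at h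

lemma integrable_truncated_mul (ρ : Measure ℝ) [IsFiniteMeasure ρ] (w : ℂ) :
    Integrable (Set.indicator {y : ℝ | |y| < 1} (fun y : ℝ => w * (y : ℂ))) ρ := by
  refine Integrable.mono' (integrable_const ‖w‖)
    (measurable_truncated_mul w).aestronglyMeasurable (ae_of_all _ fun z => ?_)
  by_cases h : |z| < 1
  · simp only [Set.mem_ofPred_eq, h, Set.indicator_of_mem, norm_mul, Complex.norm_real,
      Real.norm_eq_abs]
    nlinarith [norm_nonneg w]
  · simp [h]

/-- The mean of the jumps of size less than `1`. -/
noncomputable def truncatedMean (ρ : Measure ℝ) : ℝ :=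
  ∫ z, Set.indicator {y : ℝ | |y| < 1} (fun y : ℝ => y) z ∂ρ

lemma integral_truncated_mul (ρ : Measure ℝ) (w : ℂ) :
    ∫ z, Set.indicator {y : ℝ | |y| < 1} (fun y : ℝ => w * (y : ℂ)) z ∂ρ =
      w * truncatedMean ρ := by
  rw [truncatedMean, ← integral_complex_ofReal, ← integral_const_mul]
  refine integral_congr_ae (ae_of_all _ fun z => ?_)
  by_cases h : |z| < 1 <;> simp [h]

/-- For finite jump intensity the compensator is only a shift of the drift, which the mean of the
Gaussian factor of `jumpDiffusionLaw` absorbs. -/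
lemma integral_compensatedExp (ρ : Measure ℝ) [IsFiniteMeasure ρ] {w : ℂ}
    (hw : Integrable (fun z : ℝ => Complex.exp (w * z)) ρ) :
    ∫ z, compensatedExp w z ∂ρ =
      (∫ z : ℝ, Complex.exp (w * z) ∂ρ) - ρ.real Set.univ - w * truncatedMean ρ := by
  unfold compensatedExp
  have h1 : Integrable (fun z : ℝ => Complex.exp (w * z) - 1) ρ := hw.sub (integrable_const _)
  rw [integral_sub h1 (integrable_truncated_mul ρ w), integral_sub hw (integrable_const _),
    integral_truncated_mul]
  simp

/-! ### Laws with finite jump intensity and their exponential moments. -/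

/-- A Gaussian law convolved with a compound Poisson law of jump intensity `t ρ`, centred so
that its characteristic exponent is the one of the triplet `(m, σ, ρ)`. -/
noncomputable def jumpDiffusionLaw (m σ : ℝ) (ρ : Measure ℝ) (t : ℝ≥0) : Measure ℝ :=
  Measure.conv (gaussianReal (t * (m - truncatedMean ρ)) (t * σ ^ 2).toNNReal)
    (compoundPoisson (t • ρ))

instance isProbabilityMeasure_jumpDiffusionLaw (m σ : ℝ) (ρ : Measure ℝ) [IsFiniteMeasure ρ]
    (t : ℝ≥0) : IsProbabilityMeasure (jumpDiffusionLaw m σ ρ t) := by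
  unfold jumpDiffusionLaw; infer_instance

lemma charFun_jumpDiffusionLaw (m σ : ℝ) (ρ : Measure ℝ) [IsFiniteMeasure ρ] (t : ℝ≥0) (u : ℝ) :
    charFun (jumpDiffusionLaw m σ ρ t) u = Complex.exp ((t : ℂ) * levyExponent m σ ρ u) := by
  have hint : Integrable (fun z : ℝ => Complex.exp (Complex.I * u * z)) ρ := by
    refine Integrable.mono' (integrable_const (1 : ℝ)) (by fun_prop) (ae_of_all _ fun x => ?_)
    rw [Complex.norm_exp]; simp
  have h1 : charFun ρ u = ∫ z : ℝ, Complex.exp (Complex.I * u * z) ∂ρ := by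
    rw [charFun_apply_real]
    congr with z; ring_nf
  have h2 : charFun (t • ρ) u = t * charFun ρ u := by
    rw [charFun_apply_real, charFun_apply_real, integral_smul_nnreal_measure]
    simp [NNReal.smul_def]
  have h3 : (t • ρ).real Set.univ = t * ρ.real Set.univ := by
    simp [Measure.real]
  have h4 := integral_compensatedExp ρ hint
  unfold compensatedExp at h4
  rw [jumpDiffusionLaw, charFun_conv, charFun_gaussianReal, charFun_compoundPoisson, h2, h3,
    ← Complex.exp_add, levyExponent, h4, h1,
    Real.coe_toNNReal _ (by positivity)]
  congr 1
  push_cast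
  ring

lemma lintegral_exp_jumpDiffusionLaw (m σ : ℝ) (ρ : Measure ℝ) [IsFiniteMeasure ρ] (t : ℝ≥0)
    {θ : ℝ} (hθ : Integrable (fun z => Real.exp (θ * z)) ρ) :
    ∫⁻ x, ENNReal.ofReal (Real.exp (θ * x)) ∂(jumpDiffusionLaw m σ ρ t) =
      ENNReal.ofReal (Real.exp
        (t * (m * θ + σ ^ 2 * θ ^ 2 / 2 + (∫ z, compensatedExp θ z ∂ρ).re))) := by
  have hm : Measurable fun x : ℝ => ENNReal.ofReal (Real.exp (θ * x)) := by fun_prop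
  have hadd (x y : ℝ) : ENNReal.ofReal (Real.exp (θ * (x + y))) =
      ENNReal.ofReal (Real.exp (θ * x)) * ENNReal.ofReal (Real.exp (θ * y)) := by
    rw [← ENNReal.ofReal_mul (Real.exp_pos _).le, ← Real.exp_add, mul_add]
  have hρ : ∫⁻ x, ENNReal.ofReal (Real.exp (θ * x)) ∂(t • ρ) =
      ENNReal.ofReal (t * ∫ z, Real.exp (θ * z) ∂ρ) := by
    rw [lintegral_smul_measure, ← ofReal_integral_eq_lintegral_ofReal hθ
      (ae_of_all _ fun z => (Real.exp_pos _).le), ENNReal.ofReal_mul t.coe_nonneg, ENNReal.smul_def]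
    simp
  have hg (a : ℝ) (v : ℝ≥0) : ∫⁻ x, ENNReal.ofReal (Real.exp (θ * x)) ∂(gaussianReal a v) =
      ENNReal.ofReal (Real.exp (a * θ + v * θ ^ 2 / 2)) := by
    rw [← ofReal_integral_eq_lintegral_ofReal (integrable_exp_mul_gaussianReal θ)
      (ae_of_all _ fun z => (Real.exp_pos _).le)]
    have := congrFun (mgf_fun_id_gaussianReal (μ := a) (v := v)) θ
    rw [← this, mgf]
  have h4 := integral_compensatedExp ρ (w := (θ : ℂ)) (by exact_mod_cast hθ.ofReal)
  have h5 : (∫ z, compensatedExp θ z ∂ρ).re =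
      (∫ z, Real.exp (θ * z) ∂ρ) - ρ.real Set.univ - θ * truncatedMean ρ := by
    rw [h4]
    have : ∫ z : ℝ, Complex.exp (θ * z) ∂ρ = ((∫ z, Real.exp (θ * z) ∂ρ : ℝ) : ℂ) := by
      rw [← integral_complex_ofReal]; push_cast; rfl
    rw [this]
    norm_cast
  have h0 : 0 ≤ ∫ z, Real.exp (θ * z) ∂ρ := integral_nonneg fun z => (Real.exp_pos _).le
  rw [jumpDiffusionLaw, Measure.lintegral_conv hm]
  simp_rw [hadd]
  rw [lintegral_lintegral_mul hm.aemeasurable hm.aemeasurable, hg,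
    lintegral_compoundPoisson _ hm (by simp) hadd (by rw [hρ]; exact ENNReal.ofReal_ne_top), hρ,
    ENNReal.toReal_ofReal (by positivity), ← ENNReal.ofReal_mul (Real.exp_pos _).le,
    ← Real.exp_add, h5]
  have h3 : (t • ρ).real Set.univ = t * ρ.real Set.univ := by
    simp [Measure.real]
  rw [h3, Real.coe_toNNReal _ (by positivity)]
  congr 2
  ring

/-! ### Passage to the limit: exponential moments from the Lévy triplet. -/

/-- Fatou's lemma for weak convergence, through the portmanteau inequality on open sets. It applies
to unbounded `f`, such as exponentials, where weak convergence alone does not give convergence of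
integrals. -/
lemma lintegral_le_of_tendsto_probabilityMeasure {μs : ℕ → ProbabilityMeasure ℝ}
    {μ : ProbabilityMeasure ℝ} (h : Tendsto μs atTop (𝓝 μ)) {f : ℝ → ℝ} (hf : Continuous f)
    (hf0 : 0 ≤ f) {c : ℝ≥0∞}
    (hc : ∀ k, ∫⁻ x, ENNReal.ofReal (f x) ∂(μs k : Measure ℝ) ≤ c) :
    ∫⁻ x, ENNReal.ofReal (f x) ∂(μ : Measure ℝ) ≤ c := by
  refine (lintegral_le_liminf_lintegral_of_forall_isOpen_measure_le_liminf_measure hf hf0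
    fun G hG => ProbabilityMeasure.le_liminf_measure_open_of_tendsto h hG).trans ?_
  exact liminf_le_of_le (by isBoundedDefault) fun b hb => by
    obtain ⟨k, hk⟩ := hb.exists
    exact hk.trans (hc k)

/-- A law with characteristic function `exp (t ψ)`, where `ψ` is the exponent of a triplet whose
Lévy measure has an exponential moment of order `θ` away from the origin, has an exponential
moment of order `θ`, which grows at most exponentially in `t`. -/
theorem exists_lintegral_exp_le {ν : Measure ℝ} (hν : IsLevyMeasure ν) (m σ : ℝ) {θ : ℝ}
    (hθ : IntegrableOn (fun z : ℝ => Real.exp (θ * z)) {z : ℝ | 1 < |z|} ν) :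
    ∃ c : ℝ, ∀ (t : ℝ≥0) (μ : Measure ℝ) [IsProbabilityMeasure μ],
      (∀ u, charFun μ u = Complex.exp ((t : ℂ) * levyExponent m σ ν u)) →
      ∫⁻ x, ENNReal.ofReal (Real.exp (θ * x)) ∂μ ≤ ENNReal.ofReal (Real.exp (c * t)) := by
  have hfin (k : ℕ) : IsFiniteMeasure (ν.restrict (largeJumps k)) :=
    ⟨by rw [Measure.restrict_apply_univ]; exact hν.measure_largeJumps_lt_top k⟩
  have hI : Integrable (compensatedExp θ) ν := hν.integrable_compensatedExp (by simpa using hθ)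
  -- The norm inside the integral makes the rate an upper bound for every truncation at once.
  refine ⟨m * θ + σ ^ 2 * θ ^ 2 / 2 + ∫ z, ‖compensatedExp θ z‖ ∂ν, fun t μ _ hμ => ?_⟩
  let μs : ℕ → ProbabilityMeasure ℝ := fun k =>
    ⟨jumpDiffusionLaw m σ (ν.restrict (largeJumps k)) t, inferInstance⟩
  -- On a truncated measure, which is finite, `e^{θz}` is the integrable compensated exponential
  -- plus bounded terms.
  have hexp (k : ℕ) : Integrable (fun z => Real.exp (θ * z)) (ν.restrict (largeJumps k)) := by
    have h1 : Integrable (fun z : ℝ => compensatedExp θ z + 1 +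
        Set.indicator {y : ℝ | |y| < 1} (fun y : ℝ => (θ : ℂ) * (y : ℂ)) z)
        (ν.restrict (largeJumps k)) :=
      ((hI.restrict).add (integrable_const _)).add (integrable_truncated_mul _ _)
    refine h1.re.congr (ae_of_all _ fun z => ?_)
    have h2 : compensatedExp θ z + 1 +
        Set.indicator {y : ℝ | |y| < 1} (fun y : ℝ => (θ : ℂ) * (y : ℂ)) z =
        Complex.exp ((θ * z : ℝ) : ℂ) := by
      rw [compensatedExp, Complex.ofReal_mul]; ring
    simp only [h2]
    exact Complex.exp_ofReal_re _
  have hlim : Tendsto μs atTop (𝓝 ⟨μ, inferInstance⟩) := by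
    refine ProbabilityMeasure.tendsto_of_tendsto_charFun fun u => ?_
    simp only [μs, ProbabilityMeasure.coe_mk, charFun_jumpDiffusionLaw, hμ]
    refine (Complex.continuous_exp.tendsto _).comp (Tendsto.const_mul _ (Tendsto.const_add _ ?_))
    -- For `w = iu` the exponential has modulus one, so integrability at infinity reduces to
    -- finiteness of `ν {|z| > 1}`.
    refine hν.tendsto_setIntegral_largeJumps (f := compensatedExp (Complex.I * u)) ?_
    refine hν.integrable_compensatedExp ?_
    have hlt : ν {z : ℝ | 1 < |z|} < ∞ := by
      simpa [largeJumps] using hν.measure_largeJumps_lt_top 0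
    simpa using integrableOn_const (C := (1 : ℝ)) hlt.ne
  refine lintegral_le_of_tendsto_probabilityMeasure hlim (f := fun x => Real.exp (θ * x))
    (by fun_prop) (fun x => (Real.exp_pos _).le) fun k => ?_
  simp only [μs, ProbabilityMeasure.coe_mk]
  rw [lintegral_exp_jumpDiffusionLaw m σ _ t (hexp k), mul_comm _ (t : ℝ)]
  gcongr
  calc (∫ z in largeJumps k, compensatedExp θ z ∂ν).re
      ≤ ‖∫ z in largeJumps k, compensatedExp θ z ∂ν‖ := Complex.re_le_norm _
    _ ≤ ∫ z in largeJumps k, ‖compensatedExp θ z‖ ∂ν := norm_integral_le_integral_norm _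
    _ ≤ ∫ z, ‖compensatedExp θ z‖ ∂ν :=
      setIntegral_le_integral hI.norm (ae_of_all _ fun z => norm_nonneg _)

/-! ### Additive and multiplicative functions on the half-line. -/

/-- An additive function on `[0, ∞)` with a linear upper bound has a linear lower bound. -/
lemma exists_abs_le_mul_of_additive {g : ℝ≥0 → ℝ} (hg : ∀ s t, g (s + t) = g s + g t) {c : ℝ}
    (hc : ∀ t, g t ≤ c * t) : ∃ C : ℝ, 0 ≤ C ∧ ∀ t, |g t| ≤ C * t := by
  have hg0 : g 0 = 0 := by simpa using hg 0 0
  -- The gap `c t - g t` is additive and nonnegative, hence monotone; bounding it above linearly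
  -- bounds `g` below.
  let f : ℝ≥0 →+ ℝ :=
    { toFun := fun t => c * t - g t
      map_zero' := by simp [hg0]
      map_add' := fun s t => by rw [hg]; push_cast; ring }
  have hf0 (t : ℝ≥0) : 0 ≤ f t := sub_nonneg.2 (hc t)
  have hmono : Monotone f := fun s t hst => by
    rw [← add_tsub_cancel_of_le hst, map_add]
    linarith [hf0 (t - s)]
  have hf (t : ℝ≥0) : f t ≤ t * f 1 := by
    -- Comparing `N t` with its integer ceiling gives `N f(t) ≤ (N t + 1) f(1)`; the error stays
    -- bounded as `N` grows.
    have key (N : ℕ) : N * (f t - t * f 1) ≤ f 1 := by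
      have h1 : f (N • t) ≤ f (⌈N • t⌉₊ • (1 : ℝ≥0)) := hmono (by simpa using Nat.le_ceil _)
      rw [map_nsmul, map_nsmul, nsmul_eq_mul, nsmul_eq_mul] at h1
      have h2 : ((⌈N • t⌉₊ : ℕ) : ℝ) ≤ N * t + 1 := by
        have := (Nat.ceil_lt_add_one (zero_le (a := N • t))).le
        rw [nsmul_eq_mul] at this ⊢
        exact_mod_cast this
      nlinarith [hf0 1]
    by_contra! h
    obtain ⟨N, hN⟩ := exists_nat_gt (f 1 / (f t - t * f 1))
    rw [div_lt_iff₀ (by linarith)] at hN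
    linarith [key N]
  refine ⟨|c| + |g 1|, by positivity, fun t => abs_le.2 ⟨?_, ?_⟩⟩
  · have h := hf t
    simp only [f, AddMonoidHom.coe_mk, ZeroHom.coe_mk, NNReal.coe_one, mul_one] at h
    have := neg_abs_le (g 1)
    nlinarith [t.coe_nonneg, abs_nonneg c]
  · have := le_abs_self c
    nlinarith [hc t, t.coe_nonneg, abs_nonneg (g 1)]

/-- A positive multiplicative function on `[0, ∞)` that grows at most exponentially also decays
at most exponentially. -/
lemma exists_exp_bounds_of_multiplicative {F : ℝ≥0 → ℝ} (hF : ∀ t, 0 < F t)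
    (hmul : ∀ s t, F (s + t) = F s * F t) {c : ℝ} (hc : ∀ t, F t ≤ Real.exp (c * t)) :
    ∃ C : ℝ, 0 ≤ C ∧ ∀ t, |Real.log (F t)| ≤ C * t :=
  exists_abs_le_mul_of_additive (g := fun t => Real.log (F t))
    (fun s t => by rw [hmul, Real.log_mul (hF s).ne' (hF t).ne'])
    (fun t => (Real.log_le_iff_le_exp (hF t)).2 (hc t))

lemma abs_exp_sub_one_le_abs_mul_exp (x : ℝ) : |Real.exp x - 1| ≤ |x| * Real.exp |x| := by
  have h := Complex.norm_exp_sub_sum_le_norm_mul_exp (x : ℂ) 1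
  rw [Finset.sum_range_one] at h
  have h1 : Complex.exp x - (x : ℂ) ^ 0 / ((Nat.factorial 0 : ℕ) : ℂ) =
      ((Real.exp x - 1 : ℝ) : ℂ) := by simp
  simpa only [h1, Complex.norm_real, Real.norm_eq_abs, pow_one] using h

/-- A positive multiplicative function with an at most linear logarithm is Lipschitz and bounded
on bounded intervals. -/
lemma exists_lipschitz_of_multiplicative {F : ℝ≥0 → ℝ} (hF : ∀ t, 0 < F t)
    (hmul : ∀ s t, F (s + t) = F s * F t) {C : ℝ} (hC0 : 0 ≤ C)
    (hC : ∀ t, |Real.log (F t)| ≤ C * t) (T : ℝ≥0) :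
    ∃ K : ℝ, 0 ≤ K ∧ (∀ t ≤ T, F t ≤ K) ∧
      ∀ s t, s ≤ t → t ≤ T → |F t - F s| ≤ K * (t - s) := by
  have hle (t : ℝ≥0) (ht : t ≤ T) : F t ≤ Real.exp (C * T) := by
    rw [← Real.log_le_iff_le_exp (hF t)]
    have : (t : ℝ) ≤ T := ht
    exact (le_abs_self _).trans ((hC t).trans (by gcongr))
  have hE : 1 ≤ Real.exp (C * T) := Real.one_le_exp (by positivity)
  -- One constant serves both bounds: the first factor bounds `F`, the second bounds `|F(d) - 1| /
  -- d`. Using `C + 1` instead of `C` keeps the second factor at least one.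
  refine ⟨Real.exp (C * T) * ((C + 1) * Real.exp (C * T)), by positivity, fun t ht => ?_,
    fun s t hst ht => ?_⟩
  · refine (hle t ht).trans (le_mul_of_one_le_right (by positivity) ?_)
    nlinarith
  · obtain ⟨d, rfl⟩ := exists_add_of_le hst
    have hd : d ≤ T := le_trans le_add_self ht
    have hs : s ≤ T := hst.trans ht
    have h1 : F (s + d) - F s = F s * (Real.exp (Real.log (F d)) - 1) := by
      rw [hmul, Real.exp_log (hF d)]; ring
    have h2 : Real.exp |Real.log (F d)| ≤ Real.exp (C * T) := by
      have : (d : ℝ) ≤ T := hd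
      exact Real.exp_le_exp.2 ((hC d).trans (by gcongr))
    rw [h1, abs_mul, abs_of_pos (hF s), NNReal.coe_add, add_sub_cancel_left, mul_assoc]
    refine mul_le_mul (hle s hs) ?_ (abs_nonneg _) (by positivity)
    calc |Real.exp (Real.log (F d)) - 1| ≤ |Real.log (F d)| * Real.exp |Real.log (F d)| :=
          abs_exp_sub_one_le_abs_mul_exp _
      _ ≤ (C * d) * Real.exp (C * T) := by gcongr; exact hC d
      _ ≤ (C + 1) * Real.exp (C * T) * d := by
        nlinarith [mul_nonneg (Real.exp_pos (C * T)).le d.coe_nonneg]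

/-! ### Second moments of increments of an exponential Lévy process. -/

section Levy

variable {Ω : Type*} [MeasurableSpace Ω] {P : Measure Ω} {X : ℝ≥0 → Ω → ℝ}

/-- `X_s` is independent of the later increment because `X_0 = 0` almost surely, and that increment
has the law of `X_d`. -/
lemma IsLevyProcess.integral_exp_increment [IsProbabilityMeasure P]
    (hX : IsLevyProcess X P) (a b : ℝ) (s d : ℝ≥0) :
    ∫ ω, Real.exp (a * X s ω) * Real.exp (b * (X (s + d) ω - X s ω)) ∂P =
      mgf (X s) P a * mgf (X d) P b := by
  have hind := hX.indep_increments.indepFun_eval_sub zero_le (le_self_add (a := s) (b := d))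
    hX.start_zero
  have h := (hind.comp (φ := fun x => Real.exp (a * x)) (ψ := fun x => Real.exp (b * x))
    (by fun_prop) (by fun_prop)).integral_mul_eq_mul_integral
    ((hX.measurable s).const_mul a).exp.aestronglyMeasurable
    (((hX.measurable (s + d)).sub (hX.measurable s)).const_mul b).exp.aestronglyMeasurable
  have h2 := ((hX.stationary_increments s d).comp
    (u := fun x => Real.exp (b * x)) (by fun_prop)).integral_eq
  simp only [mgf]
  simp only [Function.comp_def, Pi.mul_def, Pi.sub_apply] at h h2
  rw [h, h2]

lemma IsLevyProcess.mgf_add [IsProbabilityMeasure P]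
    (hX : IsLevyProcess X P) (a : ℝ) (s d : ℝ≥0) :
    mgf (X (s + d)) P a = mgf (X s) P a * mgf (X d) P a := by
  rw [← hX.integral_exp_increment, mgf]
  congr with ω
  rw [← Real.exp_add]; ring_nf

lemma IsLevyProcess.integral_exp_mul_exp [IsProbabilityMeasure P]
    (hX : IsLevyProcess X P) (s d : ℝ≥0) :
    ∫ ω, Real.exp (X s ω) * Real.exp (X (s + d) ω) ∂P = mgf (X s) P 2 * mgf (X d) P 1 := by
  rw [← hX.integral_exp_increment]
  congr with ω
  rw [← Real.exp_add, ← Real.exp_add]; ring_nf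

lemma IsLevyProcessWithTriplet.exists_lintegral_exp_le [IsProbabilityMeasure P]
    {m σ : ℝ} {ν : Measure ℝ}
    (hX : IsLevyProcessWithTriplet X P m σ ν) {θ : ℝ}
    (hθ : IntegrableOn (fun z : ℝ => Real.exp (θ * z)) {z : ℝ | 1 < |z|} ν) :
    ∃ c : ℝ, ∀ t : ℝ≥0,
      ∫⁻ ω, ENNReal.ofReal (Real.exp (θ * X t ω)) ∂P ≤ ENNReal.ofReal (Real.exp (c * t)) := by
  obtain ⟨c, hc⟩ := _root_.exists_lintegral_exp_le hX.isLevyMeasure m σ hθ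
  refine ⟨c, fun t => ?_⟩
  have hm := hX.isLevyProcess.measurable t
  have := Measure.isProbabilityMeasure_map (μ := P) hm.aemeasurable
  rw [← lintegral_map (f := fun x => ENNReal.ofReal (Real.exp (θ * x))) (by fun_prop) hm]
  exact hc t _ (hX.charFun_eq t)

lemma IsLevyProcess.integrable_exp_two_mul (hX : IsLevyProcess X P) {c : ℝ}
    (hc : ∀ t : ℝ≥0, ∫⁻ ω, ENNReal.ofReal (Real.exp (2 * X t ω)) ∂P ≤
      ENNReal.ofReal (Real.exp (c * t))) (t : ℝ≥0) :
    Integrable (fun ω => Real.exp (2 * X t ω)) P := by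
  refine ⟨((hX.measurable t).const_mul 2).exp.aestronglyMeasurable, ?_⟩
  rw [hasFiniteIntegral_iff_ofReal (ae_of_all _ fun z => by positivity)]
  exact (hc t).trans_lt ENNReal.ofReal_lt_top

lemma IsLevyProcess.memLp_exp (hX : IsLevyProcess X P) {c : ℝ}
    (hc : ∀ t : ℝ≥0, ∫⁻ ω, ENNReal.ofReal (Real.exp (2 * X t ω)) ∂P ≤
      ENNReal.ofReal (Real.exp (c * t))) (t : ℝ≥0) :
    MemLp (fun ω => Real.exp (X t ω)) 2 P := by
  rw [memLp_two_iff_integrable_sq (hX.measurable t).exp.aestronglyMeasurable]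
  refine (hX.integrable_exp_two_mul hc t).congr (ae_of_all _ fun ω => ?_)
  simp only [← Real.exp_nat_mul]
  norm_num

/-- Second moments of increments of an exponential Lévy process: increments over adjacent or
disjoint intervals are nearly uncorrelated, and single increments are of order `1 / 2`. -/
theorem IsLevyProcess.exists_increment_bounds [IsProbabilityMeasure P]
    (hX : IsLevyProcess X P) {c : ℝ}
    (hc : ∀ t : ℝ≥0, ∫⁻ ω, ENNReal.ofReal (Real.exp (2 * X t ω)) ∂P ≤
      ENNReal.ofReal (Real.exp (c * t))) (T : ℝ≥0) :
    ∃ K : ℝ, 0 ≤ K ∧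
      (∀ s s' t t' : ℝ≥0, s ≤ s' → s' ≤ t → t ≤ t' → t' ≤ T →
        ∫ ω, (Real.exp (X s' ω) - Real.exp (X s ω)) * (Real.exp (X t' ω) - Real.exp (X t ω)) ∂P
          ≤ K * ((s' - s) * (t' - t))) ∧
      (∀ s s' : ℝ≥0, s ≤ s' → s' ≤ T →
        ∫ ω, (Real.exp (X s' ω) - Real.exp (X s ω)) ^ 2 ∂P ≤ K * (s' - s)) := by
  have hI2 := hX.integrable_exp_two_mul hc
  have hmem := hX.memLp_exp hc
  have hI1 (t : ℝ≥0) : Integrable (fun ω => Real.exp (1 * X t ω)) P := by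
    simpa using (hmem t).integrable one_le_two
  set φ : ℝ≥0 → ℝ := fun t => mgf (X t) P 1 with hφ
  set ψ : ℝ≥0 → ℝ := fun t => mgf (X t) P 2 with hψ
  have hφ0 (t) : 0 < φ t := mgf_pos (hI1 t)
  have hψ0 (t) : 0 < ψ t := mgf_pos (hI2 t)
  have hφm (s t) : φ (s + t) = φ s * φ t := hX.mgf_add 1 s t
  have hψm (s t) : ψ (s + t) = ψ s * ψ t := hX.mgf_add 2 s t
  have hψc (t : ℝ≥0) : ψ t ≤ Real.exp (c * t) := by
    have h := hc t
    rw [← ofReal_integral_eq_lintegral_ofReal (hI2 t) (ae_of_all _ fun z => (Real.exp_pos _).le)]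
      at h
    exact (ENNReal.ofReal_le_ofReal_iff (Real.exp_pos _).le).1 h
  -- Nonnegativity of the variance lets the growth bound for the second moment control the first as
  -- well.
  have hφψ (t : ℝ≥0) : φ t ^ 2 ≤ ψ t := by
    have h := variance_nonneg (fun ω => Real.exp (X t ω)) P
    rw [variance_eq_sub (hmem t)] at h
    have h1 : ∫ ω, (Real.exp (X t ω)) ^ 2 ∂P = ψ t := by
      simp only [hψ, mgf, ← Real.exp_nat_mul]; norm_num
    have h2 : ∫ ω, Real.exp (X t ω) ∂P = φ t := by simp [hφ, mgf]
    simp only [Pi.pow_apply] at h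
    rw [h1, h2] at h
    linarith
  have hφc (t : ℝ≥0) : φ t ≤ Real.exp (c / 2 * t) := by
    have h := (hφψ t).trans (hψc t)
    have : Real.exp (c * t) = Real.exp (c / 2 * t) ^ 2 := by
      rw [← Real.exp_nat_mul]; push_cast; ring_nf
    rw [this] at h
    exact le_of_sq_le_sq h (Real.exp_pos _).le
  obtain ⟨C₁, hC₁0, hC₁⟩ := exists_exp_bounds_of_multiplicative hφ0 hφm hφc
  obtain ⟨C₂, hC₂0, hC₂⟩ := exists_exp_bounds_of_multiplicative hψ0 hψm hψc
  set r : ℝ≥0 → ℝ := fun t => ψ t / φ t with hr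
  have hr0 (t) : 0 < r t := div_pos (hψ0 t) (hφ0 t)
  have hrm (s t) : r (s + t) = r s * r t := by
    simp only [hr, hφm, hψm]; rw [mul_div_mul_comm]
  have hrC (t : ℝ≥0) : |Real.log (r t)| ≤ (C₂ + C₁) * t := by
    rw [hr, Real.log_div (hψ0 t).ne' (hφ0 t).ne']
    exact (abs_sub _ _).trans (by linarith [hC₁ t, hC₂ t])
  obtain ⟨A, hA0, hA, hAl⟩ := exists_lipschitz_of_multiplicative hφ0 hφm hC₁0 hC₁ T
  obtain ⟨B, hB0, hB, hBl⟩ := exists_lipschitz_of_multiplicative hr0 hrm (by positivity) hrC T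
  -- The factorisation behind the theorem: the earlier and later times separate, so expectations of
  -- products of successive increments factor into differences of `r` and of `φ`.
  have hE (s t : ℝ≥0) (hst : s ≤ t) :
      ∫ ω, Real.exp (X s ω) * Real.exp (X t ω) ∂P = r s * φ t := by
    obtain ⟨d, rfl⟩ := exists_add_of_le hst
    rw [hX.integral_exp_mul_exp, hφm]
    change ψ s * φ d = ψ s / φ s * (φ s * φ d)
    field_simp [(hφ0 s).ne']
  have hint (s t : ℝ≥0) : Integrable (fun ω => Real.exp (X s ω) * Real.exp (X t ω)) P :=
    (hmem s).integrable_mul (hmem t)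
  have hcross (s s' t t' : ℝ≥0) :
      ∫ ω, (Real.exp (X s' ω) - Real.exp (X s ω)) * (Real.exp (X t' ω) - Real.exp (X t ω)) ∂P =
      (∫ ω, Real.exp (X s' ω) * Real.exp (X t' ω) ∂P)
        - (∫ ω, Real.exp (X s' ω) * Real.exp (X t ω) ∂P)
        - ((∫ ω, Real.exp (X s ω) * Real.exp (X t' ω) ∂P)
        - (∫ ω, Real.exp (X s ω) * Real.exp (X t ω) ∂P)) := by
    have hint2 (t s s' : ℝ≥0) : Integrable (fun ω =>
        Real.exp (X t ω) * Real.exp (X s' ω) - Real.exp (X t ω) * Real.exp (X s ω)) P :=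
      (hint _ _).sub (hint _ _)
    rw [← integral_sub (hint _ _) (hint _ _), ← integral_sub (hint _ _) (hint _ _),
      ← integral_sub (hint2 _ _ _) (hint2 _ _ _)]
    congr with ω
    ring
  -- Separate increments need only `A B`. The factor two is for the square, equal to `φ(s') (r(s') -
  -- r(s)) + r(s) (φ(s) - φ(s'))`: each summand is of first order, with no further cancellation
  -- used.
  refine ⟨2 * (A * B), by positivity, fun s s' t t' h1 h2 h3 h4 => ?_, fun s s' h1 h2 => ?_⟩
  · rw [hcross, hE s' t' (h2.trans h3), hE s' t h2, hE s t' (h1.trans (h2.trans h3)),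
      hE s t (h1.trans h2)]
    have ha := hAl t t' h3 h4
    have hb := hBl s s' h1 (h2.trans (h3.trans h4))
    have hd : (0 : ℝ) ≤ s' - s := sub_nonneg.2 h1
    have he : (0 : ℝ) ≤ t' - t := sub_nonneg.2 h3
    calc r s' * φ t' - r s' * φ t - (r s * φ t' - r s * φ t)
        = (r s' - r s) * (φ t' - φ t) := by ring
      _ ≤ |r s' - r s| * |φ t' - φ t| := by rw [← abs_mul]; exact le_abs_self _
      _ ≤ (B * (s' - s)) * (A * (t' - t)) := by gcongr
      _ ≤ 2 * (A * B) * ((s' - s) * (t' - t)) := by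
        have : 0 ≤ A * B * ((s' - s) * (t' - t)) := by positivity
        linarith
  · simp_rw [sq]
    have hsym : ∫ ω, Real.exp (X s' ω) * Real.exp (X s ω) ∂P = r s * φ s' := by
      rw [← hE s s' h1]; simp_rw [mul_comm]
    rw [hcross, hE s' s' le_rfl, hsym, hE s s' h1, hE s s le_rfl]
    have ha := (neg_abs_le _).trans' (neg_le_neg (hAl s s' h1 h2))
    have hb := (le_abs_self _).trans (hBl s s' h1 h2)
    have hd : (0 : ℝ) ≤ s' - s := sub_nonneg.2 h1
    have h3 : φ s' * (r s' - r s) ≤ A * (B * (s' - s)) :=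
      (mul_le_mul_of_nonneg_left hb (hφ0 _).le).trans
        (mul_le_mul_of_nonneg_right (hA s' h2) (by positivity))
    have h4 : r s * (φ s - φ s') ≤ B * (A * (s' - s)) :=
      (mul_le_mul_of_nonneg_left (by linarith) (hr0 _).le).trans
        (mul_le_mul_of_nonneg_right (hB s (h1.trans h2)) (by positivity))
    linarith

end Levy

/-! ### Riemann sums along càdlàg paths. -/

/-- The right-endpoint Riemann sum of `g` over `[0, T]` with `n` uniform steps. -/
noncomputable def rightSum (g : ℝ → ℝ) (T : ℝ) (n : ℕ) : ℝ :=
  T / n * ∑ j ∈ Finset.range n, g (((j : ℝ) + 1) * (T / n))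

/-- Each point has a neighbourhood on which the path is bounded, by the left limit on one side and
right continuity on the other; compactness makes the bound uniform. -/
lemma IsCadlagPath.exists_bound {x : ℝ≥0 → ℝ} (hx : IsCadlagPath x) (T : ℝ≥0) :
    ∃ B, ∀ t ≤ T, |x t| ≤ B := by
  have hc : IsCompact (Set.Icc (0 : ℝ≥0) T) := isCompact_Icc
  have := hc.induction_on (p := fun s => ∃ B, ∀ t ∈ s, |x t| ≤ B) ⟨0, by simp⟩
    (fun s t hst ⟨B, hB⟩ => ⟨B, fun u hu => hB u (hst hu)⟩)
    (fun s t ⟨B, hB⟩ ⟨B', hB'⟩ => ⟨max B B', fun u hu => hu.elim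
      (fun h => (hB u h).trans (le_max_left _ _)) (fun h => (hB' u h).trans (le_max_right _ _))⟩)
    (fun t _ => ?_)
  · obtain ⟨B, hB⟩ := this
    exact ⟨B, fun t ht => hB t ⟨zero_le, ht⟩⟩
  · obtain ⟨hr, l, hl⟩ := hx t
    have h1 : ∀ᶠ u in 𝓝[<] t, |x u| < |l| + 1 := hl.abs.eventually_lt_const (by linarith)
    have h2 : ∀ᶠ u in 𝓝[≥] t, |x u| < |x t| + 1 := hr.abs.eventually_lt_const (by linarith)
    refine ⟨{u | |x u| ≤ max (|l| + 1) (|x t| + 1)}, ?_, _, fun u hu => hu⟩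
    refine mem_nhdsWithin_of_mem_nhds ?_
    rw [← nhdsLT_sup_nhdsGE]
    exact ⟨h1.mono fun u hu => hu.le.trans (le_max_left _ _),
      h2.mono fun u hu => hu.le.trans (le_max_right _ _)⟩

/-- Rounding time up to the grid turns the sum into the integral of a step function, a form suited
to dominated convergence. -/
lemma rightSum_eq_integral (g : ℝ → ℝ) {T : ℝ} (hT : 0 < T) {n : ℕ} (hn : 1 ≤ n) :
    rightSum g T n = ∫ t in (0 : ℝ)..T, g (⌈t / (T / n)⌉ * (T / n)) := by
  have hn' : (0 : ℝ) < n := by exact_mod_cast hn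
  set h := T / n with hh
  have hpos : 0 < h := by positivity
  have hcongr (j : ℕ) : Set.EqOn (fun t : ℝ => g (⌈t / h⌉ * h)) (fun _ => g (((j : ℝ) + 1) * h))
      (Set.uIoc (j * h) (((j + 1 : ℕ) : ℝ) * h)) := by
    intro t ht
    rw [Set.uIoc_of_le (by push_cast; nlinarith)] at ht
    have : ⌈t / h⌉ = (j : ℤ) + 1 := by
      rw [Int.ceil_eq_iff]
      push_cast
      refine ⟨?_, ?_⟩
      · rw [lt_div_iff₀ hpos]; linarith [ht.1]
      · rw [div_le_iff₀ hpos]; have := ht.2; push_cast at this; exact this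
    simp only [this]
    push_cast
    rfl
  have hsum := intervalIntegral.sum_integral_adjacent_intervals
    (f := fun t : ℝ => g (⌈t / h⌉ * h)) (μ := volume) (a := fun j : ℕ => (j : ℝ) * h) (n := n)
    (fun j _ => (intervalIntegrable_congr (hcongr j)).2 intervalIntegrable_const)
  have hend : (n : ℝ) * h = T := by rw [hh]; field_simp
  simp only [Nat.cast_zero, zero_mul, hend] at hsum
  rw [rightSum, ← hsum, Finset.mul_sum]
  refine Finset.sum_congr rfl fun j _ => ?_
  rw [intervalIntegral.integral_congr_ae (ae_of_all _ fun t ht => hcongr j ht),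
    intervalIntegral.integral_const]
  push_cast
  rw [smul_eq_mul]
  ring

/-- Right-endpoint Riemann sums of bounded right-continuous functions converge to the integral. -/
lemma tendsto_rightSum {g : ℝ → ℝ} {T : ℝ} (hT : 0 < T)
    (hg : ∀ t, 0 ≤ t → ContinuousWithinAt g (Set.Ici t) t) {B : ℝ}
    (hB : ∀ t, 0 ≤ t → t ≤ T → |g t| ≤ B) :
    Tendsto (rightSum g T) atTop (𝓝 (∫ t in (0 : ℝ)..T, g t)) := by
  have hlim : Tendsto (fun n : ℕ => ∫ t in (0 : ℝ)..T, g (⌈t / (T / n)⌉ * (T / n))) atTop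
      (𝓝 (∫ t in (0 : ℝ)..T, g t)) := by
    refine intervalIntegral.tendsto_integral_filter_of_dominated_convergence (fun _ => B) ?_ ?_
      intervalIntegrable_const ?_
    · refine Eventually.of_forall fun n => ?_
      have h1 : Measurable fun k : ℤ => g (k * (T / n)) := measurable_from_top
      exact (h1.comp (Int.measurable_ceil.comp
        (measurable_id.div_const (T / n)))).aestronglyMeasurable
    · filter_upwards [eventually_ge_atTop 1] with n hn
      refine ae_of_all _ fun t ht => ?_
      rw [Set.uIoc_of_le hT.le] at ht
      have hn' : (0 : ℝ) < n := by exact_mod_cast hn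
      have hpos : 0 < T / n := by positivity
      have h0 : 0 < t / (T / n) := div_pos ht.1 hpos
      refine hB _ (mul_nonneg (by exact_mod_cast Int.ceil_nonneg h0.le) hpos.le) ?_
      have h1 : ⌈t / (T / n)⌉ ≤ (n : ℤ) := by
        rw [Int.ceil_le, div_le_iff₀ hpos]
        push_cast
        rw [mul_div_cancel₀ _ hn'.ne']
        exact ht.2
      calc (⌈t / (T / n)⌉ : ℝ) * (T / n) ≤ n * (T / n) := by
            gcongr; exact_mod_cast h1
        _ = T := mul_div_cancel₀ _ hn'.ne'
    · refine ae_of_all _ fun t ht => ?_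
      rw [Set.uIoc_of_le hT.le] at ht
      -- Grid points rounded up approach `t` from the right, so right continuity gives convergence
      -- at every `t`; this is the reason for right-endpoint sums.
      refine (hg t ht.1.le).tendsto.comp (tendsto_nhdsWithin_iff.2 ⟨?_, ?_⟩)
      · have hh : Tendsto (fun n : ℕ => t + T / n) atTop (𝓝 t) := by
          simpa using (tendsto_const_div_atTop_nhds_zero_nat T).const_add t
        refine tendsto_of_tendsto_of_tendsto_of_le_of_le' tendsto_const_nhds hh ?_ ?_
        · filter_upwards [eventually_ge_atTop 1] with n hn
          have hn' : (0 : ℝ) < n := by exact_mod_cast hn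
          rw [← div_le_iff₀ (by positivity)]
          exact Int.le_ceil _
        · filter_upwards [eventually_ge_atTop 1] with n hn
          have hn' : (0 : ℝ) < n := by exact_mod_cast hn
          have hpos : 0 < T / n := by positivity
          have := (Int.ceil_lt_add_one (t / (T / n))).le
          calc (⌈t / (T / n)⌉ : ℝ) * (T / n) ≤ (t / (T / n) + 1) * (T / n) := by gcongr
            _ = t + T / n := by field_simp
      · filter_upwards [eventually_ge_atTop 1] with n hn
        have hn' : (0 : ℝ) < n := by exact_mod_cast hn
        rw [Set.mem_Ici, ← div_le_iff₀ (by positivity)]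
        exact Int.le_ceil _
  refine hlim.congr' ?_
  filter_upwards [eventually_ge_atTop 1] with n hn
  exact (rightSum_eq_integral g hT hn).symm

lemma IsCadlagPath.tendsto_rightSum_exp {x : ℝ≥0 → ℝ} (hx : IsCadlagPath x) {T : ℝ} (hT : 0 < T) :
    Tendsto (rightSum (fun t => Real.exp (x t.toNNReal)) T) atTop
      (𝓝 (∫ t in (0 : ℝ)..T, Real.exp (x t.toNNReal))) := by
  obtain ⟨B, hB⟩ := hx.exists_bound T.toNNReal
  refine tendsto_rightSum hT (fun t ht => ?_) (B := Real.exp B) fun t ht htT => ?_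
  · refine Real.continuous_exp.continuousAt.comp_continuousWithinAt ?_
    exact (hx t.toNNReal).1.comp continuous_real_toNNReal.continuousWithinAt
      fun s hs => Real.toNNReal_le_toNNReal hs
  · rw [abs_of_pos (Real.exp_pos _)]
    exact Real.exp_le_exp.2 ((le_abs_self _).trans (hB _ (Real.toNNReal_le_toNNReal htT)))

/-! ### Mean-square comparison of coarse and refined sums. -/

lemma sum_range_mul_eq (f : ℕ → ℝ) (n m : ℕ) :
    ∑ i ∈ Finset.range (n * m), f i =
      ∑ j ∈ Finset.range n, ∑ k ∈ Finset.range m, f (j * m + k) := by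
  induction n with
  | zero => simp
  | succ n ih => rw [Nat.succ_mul, Finset.sum_range_add, ih, Finset.sum_range_succ]

/-- The difference of a coarse and a refined Riemann sum as a sum of increments. -/
lemma rightSum_sub_rightSum_mul (g : ℝ → ℝ) (T : ℝ) {n m : ℕ} (hn : 1 ≤ n) (hm : 1 ≤ m) :
    rightSum g T n - rightSum g T (n * m) =
      T / (n * m) * ∑ p ∈ Finset.range n ×ˢ Finset.range m,
        (g (((p.1 : ℝ) + 1) * (T / n)) - g (((p.1 : ℝ) * m + p.2 + 1) * (T / (n * m)))) := by
  have hn' : (n : ℝ) ≠ 0 := by positivity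
  have hm' : (m : ℝ) ≠ 0 := by positivity
  rw [rightSum, rightSum, sum_range_mul_eq, Finset.sum_product]
  simp only [Finset.sum_sub_distrib, Finset.sum_const, Finset.card_range, nsmul_eq_mul]
  push_cast
  rw [← Finset.mul_sum]
  field_simp

/-- Mean-square distance of a coarse and a refined Riemann sum of a process whose increments over
disjoint intervals are nearly uncorrelated. -/
theorem integral_sq_rightSum_sub_le {Ω : Type*} [MeasurableSpace Ω] {P : Measure Ω}
    {Y : ℝ → Ω → ℝ} (hY : ∀ t, MemLp (Y t) 2 P) {T K : ℝ} (hT : 0 < T) (hK : 0 ≤ K)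
    (hcross : ∀ s s' t t' : ℝ, 0 ≤ s → s ≤ s' → s' ≤ t → t ≤ t' → t' ≤ T →
      ∫ ω, (Y s' ω - Y s ω) * (Y t' ω - Y t ω) ∂P ≤ K * ((s' - s) * (t' - t)))
    (hsq : ∀ s s' : ℝ, 0 ≤ s → s ≤ s' → s' ≤ T →
      ∫ ω, (Y s' ω - Y s ω) ^ 2 ∂P ≤ K * (s' - s)) {n m : ℕ} (hn : 1 ≤ n) (hm : 1 ≤ m) :
    ∫ ω, (rightSum (fun t => Y t ω) T n - rightSum (fun t => Y t ω) T (n * m)) ^ 2 ∂P ≤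
      K * (T ^ 2 + T) * (T / n) ^ 2 := by
  have hn' : (0 : ℝ) < n := by positivity
  have hm' : (0 : ℝ) < m := by positivity
  set h : ℝ := T / n with hh
  set δ : ℝ := T / (n * m) with hδ
  have hpos : 0 < h := by positivity
  have hδpos : 0 < δ := by positivity
  have hmδ : m * δ = h := by rw [hδ, hh]; field_simp
  have hnh : n * h = T := by rw [hh]; field_simp
  let b : ℕ × ℕ → ℝ := fun p => ((p.1 : ℝ) + 1) * h
  let a : ℕ × ℕ → ℝ := fun p => ((p.1 : ℝ) * m + p.2 + 1) * δ
  -- The increment from a fine grid point to the right end of the coarse block containing it; the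
  -- pair records the block and the position inside it.
  let D : ℕ × ℕ → Ω → ℝ := fun p ω => Y (b p) ω - Y (a p) ω
  set I := Finset.range n ×ˢ Finset.range m with hI
  have ha (p : ℕ × ℕ) : a p = p.1 * h + (p.2 + 1) * δ := by
    simp only [a]; rw [← hmδ]; ring
  have ha0 (p : ℕ × ℕ) : p.1 * h ≤ a p := by
    rw [ha]; have : 0 ≤ ((p.2 : ℝ) + 1) * δ := by positivity
    linarith
  have ha0' (p : ℕ × ℕ) : 0 ≤ a p := le_trans (by positivity) (ha0 p)
  have hab {p : ℕ × ℕ} (hp : p ∈ I) : a p ≤ b p := by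
    have h2 : p.2 + 1 ≤ m := (Finset.mem_range.1 (Finset.mem_product.1 hp).2)
    have h2' : (p.2 : ℝ) + 1 ≤ m := by exact_mod_cast h2
    rw [ha]
    simp only [b]
    nlinarith
  have hba (p : ℕ × ℕ) : b p - a p ≤ h := by
    have := ha0 p
    simp only [b]
    linarith
  have hbT {p : ℕ × ℕ} (hp : p ∈ I) : b p ≤ T := by
    have h1 : p.1 + 1 ≤ n := (Finset.mem_range.1 (Finset.mem_product.1 hp).1)
    have h1' : (p.1 : ℝ) + 1 ≤ n := by exact_mod_cast h1
    rw [← hnh]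
    simp only [b]
    gcongr
  have hD (p) : MemLp (D p) 2 P := (hY _).sub (hY _)
  have hDD (p q) : Integrable (fun ω => D p ω * D q ω) P := (hD p).integrable_mul (hD q)
  have hlt {p q : ℕ × ℕ} (hp : p ∈ I) (hq : q ∈ I) (hpq : p.1 < q.1) :
      ∫ ω, D p ω * D q ω ∂P ≤ K * h ^ 2 := by
    have h1 : p.1 + 1 ≤ q.1 := hpq
    have h1' : (p.1 : ℝ) + 1 ≤ q.1 := by exact_mod_cast h1
    have hbq : b p ≤ a q := le_trans (by simp only [b]; gcongr) (ha0 q)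
    refine (hcross _ _ _ _ (ha0' p) (hab hp) hbq (hab hq) (hbT hq)).trans ?_
    rw [sq]
    have := sub_nonneg.2 (hab hp)
    have := sub_nonneg.2 (hab hq)
    gcongr
    · exact hba p
    · exact hba q
  -- Different blocks give disjoint intervals and the bound `K h²`. Within one block the intervals
  -- overlap, and `xy ≤ (x² + y²)/2` leaves only `K h`.
  have hbound {p q : ℕ × ℕ} (hp : p ∈ I) (hq : q ∈ I) :
      ∫ ω, D p ω * D q ω ∂P ≤ K * h ^ 2 + if p.1 = q.1 then K * h else 0 := by
    rcases lt_trichotomy p.1 q.1 with hpq | hpq | hpq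
    · rw [if_neg hpq.ne, add_zero]; exact hlt hp hq hpq
    · rw [if_pos hpq]
      have hone {p : ℕ × ℕ} (hp : p ∈ I) : ∫ ω, D p ω ^ 2 ∂P ≤ K * h :=
        (hsq _ _ (ha0' p) (hab hp) (hbT hp)).trans (by gcongr; exact hba p)
      have hi (p) : Integrable (fun ω => D p ω ^ 2) P := (hD p).integrable_sq
      have hmono : ∫ ω, D p ω * D q ω ∂P ≤ ∫ ω, (D p ω ^ 2 + D q ω ^ 2) / 2 ∂P :=
        integral_mono (hDD p q) (((hi p).add (hi q)).div_const 2) fun ω => by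
          show D p ω * D q ω ≤ (D p ω ^ 2 + D q ω ^ 2) / 2
          nlinarith [sq_nonneg (D p ω - D q ω)]
      rw [integral_div, integral_add (hi p) (hi q)] at hmono
      have : 0 ≤ K * h ^ 2 := by positivity
      linarith [hone hp, hone hq]
    · rw [if_neg hpq.ne', add_zero]
      simp_rw [mul_comm (D p _)]
      exact hlt hq hp hpq
  have hexpand (ω : Ω) :
      (rightSum (fun t => Y t ω) T n - rightSum (fun t => Y t ω) T (n * m)) ^ 2 =
        δ ^ 2 * ∑ p ∈ I, ∑ q ∈ I, D p ω * D q ω := by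
    rw [rightSum_sub_rightSum_mul _ _ hn hm, mul_pow, sq (∑ p ∈ I, _), Finset.sum_mul_sum]
  simp_rw [hexpand]
  rw [integral_const_mul, integral_finsetSum _ fun p _ => integrable_finsetSum _ fun q _ =>
    hDD p q]
  simp_rw [integral_finsetSum _ fun q _ => hDD _ q]
  -- All `(nm)²` pairs carry `K h²`, and the `n m²` pairs sharing a block carry the extra `K h`.
  -- After multiplication by `δ² = (h/m)²`, the identity `n h = T` yields `T²` and `T` respectively,
  -- with no dependence on `m`.
  have hcount : ∑ p ∈ I, ∑ q ∈ I, (K * h ^ 2 + if p.1 = q.1 then K * h else 0) =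
      (n * m) ^ 2 * (K * h ^ 2) + n * m ^ 2 * (K * h) := by
    have hinner (p : ℕ × ℕ) (hp : p ∈ I) :
        ∑ q ∈ I, (K * h ^ 2 + if p.1 = q.1 then K * h else 0) =
          n * m * (K * h ^ 2) + m * (K * h) := by
      have hp1 := (Finset.mem_product.1 hp).1
      rw [Finset.sum_add_distrib, hI, Finset.sum_product_right (f := fun q : ℕ × ℕ =>
        if p.1 = q.1 then K * h else 0)]
      simp only [Finset.sum_ite_eq, if_pos hp1, Finset.sum_const, Finset.card_product,
        Finset.card_range, nsmul_eq_mul]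
      push_cast
      ring
    rw [Finset.sum_congr rfl hinner, Finset.sum_const, hI, Finset.card_product,
      Finset.card_range, Finset.card_range, nsmul_eq_mul]
    push_cast
    ring
  calc δ ^ 2 * ∑ p ∈ I, ∑ q ∈ I, ∫ ω, D p ω * D q ω ∂P
      ≤ δ ^ 2 * ∑ p ∈ I, ∑ q ∈ I, (K * h ^ 2 + if p.1 = q.1 then K * h else 0) := by
        gcongr with p hp q hq
        exact hbound hp hq
    _ = K * ((n * (m * δ)) ^ 2 + n * (m * δ) * (m * δ) / h) * h ^ 2 := by
        rw [hcount]; field_simp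
    _ = K * (T ^ 2 + T) * h ^ 2 := by
        rw [hmδ, hnh]; field_simp

/-! ### The mean-square error of the trapezoidal average. -/

section Asian

variable {Ω : Type*} [MeasurableSpace Ω] {P : Measure Ω} {X : ℝ≥0 → Ω → ℝ}

lemma eLpNorm_two_le_iff {f : Ω → ℝ} (hf : MemLp f 2 P) {b : ℝ} (hb : 0 ≤ b) :
    eLpNorm f 2 P ≤ ENNReal.ofReal b ↔ ∫ ω, f ω ^ 2 ∂P ≤ b ^ 2 := by
  have h0 : 0 ≤ ∫ ω, f ω ^ 2 ∂P := integral_nonneg fun ω => sq_nonneg _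
  rw [hf.eLpNorm_eq_integral_rpow_norm (by norm_num) (by norm_num),
    ENNReal.ofReal_le_ofReal_iff hb]
  simp only [ENNReal.toReal_ofNat, Real.rpow_ofNat, Real.norm_eq_abs, sq_abs]
  rw [← one_div, ← Real.sqrt_eq_rpow, Real.sqrt_le_iff]
  exact and_iff_right hb

lemma integral_abs_le_of_integral_sq_le [IsProbabilityMeasure P] {f : Ω → ℝ} (hf : MemLp f 2 P)
    {b : ℝ} (hb : 0 ≤ b) (h : ∫ ω, f ω ^ 2 ∂P ≤ b ^ 2) : ∫ ω, |f ω| ∂P ≤ b := by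
  have hv := variance_nonneg (fun ω => |f ω|) P
  rw [variance_eq_sub (X := fun ω => |f ω|) hf.abs] at hv
  simp only [Pi.pow_apply, sq_abs] at hv
  exact le_of_sq_le_sq (by linarith) hb

/-- Trapezoidal and right-endpoint sums differ by half of a telescoping sum, leaving only the two
end values. -/
lemma trapezoidalAverage_eq {Ω : Type*} (X : ℝ≥0 → Ω → ℝ) (S₀ T : ℝ) {n : ℕ} (hn : 1 ≤ n) (ω : Ω) :
    trapezoidalAverage X S₀ T n ω =
      S₀ * T⁻¹ * (rightSum (fun t => Real.exp (X t.toNNReal ω)) T n +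
        T / n / 2 * (Real.exp (X 0 ω) - Real.exp (X T.toNNReal ω))) := by
  have hn' : (n : ℝ) ≠ 0 := by positivity
  have h := Finset.sum_range_sub
    (fun j : ℕ => Real.exp (X ((j : ℝ) * (T / n)).toNNReal ω)) n
  have hend : (n : ℝ) * (T / n) = T := by field_simp
  simp only [Nat.cast_add, Nat.cast_one, Finset.sum_sub_distrib, hend, Nat.cast_zero, zero_mul,
    Real.toNNReal_zero] at h
  rw [trapezoidalAverage, rightSum, ← Finset.mul_sum, Finset.sum_add_distrib]
  linear_combination (-(S₀ * T⁻¹ * (T / n) / 2)) * h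

lemma memLp_rightSum_exp (hX : ∀ t, MemLp (fun ω => Real.exp (X t ω)) 2 P) (T : ℝ) (n : ℕ) :
    MemLp (fun ω => rightSum (fun t => Real.exp (X t.toNNReal ω)) T n) 2 P :=
  (memLp_finsetSum (f := fun (j : ℕ) ω => Real.exp (X (((j : ℝ) + 1) * (T / n)).toNNReal ω)) _
    fun _ _ => hX _).const_mul _

lemma memLp_trapezoidalAverage (hX : ∀ t, MemLp (fun ω => Real.exp (X t ω)) 2 P) (S₀ T : ℝ)
    {n : ℕ} (hn : 1 ≤ n) : MemLp (trapezoidalAverage X S₀ T n) 2 P := by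
  rw [funext (trapezoidalAverage_eq X S₀ T hn)]
  exact ((memLp_rightSum_exp hX T n).add (((hX 0).sub (hX _)).const_mul _)).const_mul _

/-- The trapezoidal approximation of the average of an exponential Lévy process with finite second
moments is accurate to first order in mean square. -/
theorem IsLevyProcess.exists_trapezoidal_error_bound [IsProbabilityMeasure P]
    (hX : IsLevyProcess X P) {c : ℝ}
    (hc : ∀ t : ℝ≥0, ∫⁻ ω, ENNReal.ofReal (Real.exp (2 * X t ω)) ∂P ≤
      ENNReal.ofReal (Real.exp (c * t))) {S₀ T : ℝ} (hS₀ : 0 < S₀) (hT : 0 < T) :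
    ∃ D : ℝ, 0 ≤ D ∧ ∀ n : ℕ, 1 ≤ n →
      MemLp (fun ω => trapezoidalAverage X S₀ T n ω - asianAverage X S₀ T ω) 2 P ∧
      ∫ ω, (trapezoidalAverage X S₀ T n ω - asianAverage X S₀ T ω) ^ 2 ∂P ≤
        (D * (T / n)) ^ 2 := by
  have hmem := hX.memLp_exp hc
  obtain ⟨K, hK0, hcross, hsq⟩ := hX.exists_increment_bounds hc T.toNNReal
  let Y : ℝ → Ω → ℝ := fun t ω => Real.exp (X t.toNNReal ω)
  have hmain {n m : ℕ} (hn : 1 ≤ n) (hm : 1 ≤ m) :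
      ∫ ω, (rightSum (fun t => Y t ω) T n - rightSum (fun t => Y t ω) T (n * m)) ^ 2 ∂P ≤
        K * (T ^ 2 + T) * (T / n) ^ 2 := by
    refine integral_sq_rightSum_sub_le (fun t => hmem _) hT hK0 (fun s s' t t' h0 h1 h2 h3 h4 => ?_)
      (fun s s' h0 h1 h2 => ?_) hn hm
    · have := hcross s.toNNReal s'.toNNReal t.toNNReal t'.toNNReal (Real.toNNReal_le_toNNReal h1)
        (Real.toNNReal_le_toNNReal h2) (Real.toNNReal_le_toNNReal h3)
        (Real.toNNReal_le_toNNReal h4)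
      rwa [Real.coe_toNNReal _ h0, Real.coe_toNNReal _ (h0.trans h1),
        Real.coe_toNNReal _ (h0.trans (h1.trans h2)),
        Real.coe_toNNReal _ (h0.trans (h1.trans (h2.trans h3)))] at this
    · have := hsq s.toNNReal s'.toNNReal (Real.toNNReal_le_toNNReal h1)
        (Real.toNNReal_le_toNNReal h2)
      rwa [Real.coe_toNNReal _ h0, Real.coe_toNNReal _ (h0.trans h1)] at this
  have hR (n : ℕ) : MemLp (fun ω => rightSum (fun t => Y t ω) T n) 2 P :=
    memLp_rightSum_exp hmem T n
  set A : ℝ := √(K * (T ^ 2 + T)) with hA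
  have hA2 : A ^ 2 = K * (T ^ 2 + T) := Real.sq_sqrt (by positivity)
  set E : ℝ := (eLpNorm (fun ω => Real.exp (X 0 ω) - Real.exp (X T.toNNReal ω)) 2 P).toReal
  have hEmem : MemLp (fun ω => Real.exp (X 0 ω) - Real.exp (X T.toNNReal ω)) 2 P :=
    (hmem 0).sub (hmem _)
  -- `A` comes from the Riemann sum error and `E / 2` from the endpoint correction.
  refine ⟨S₀ * T⁻¹ * (A + E / 2), by positivity, fun n hn => ?_⟩
  have hn' : (0 : ℝ) < n := by positivity
  -- The coarse sum is held fixed while its refinement tends to the integral; `m + 1` keeps the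
  -- refinement factor positive.
  have hlim : ∀ᵐ ω ∂P, Tendsto (fun m : ℕ => rightSum (fun t => Y t ω) T n -
      rightSum (fun t => Y t ω) T (n * (m + 1))) atTop
      (𝓝 (rightSum (fun t => Y t ω) T n - ∫ t in (0 : ℝ)..T, Y t ω)) := by
    filter_upwards [hX.cadlag] with ω hω
    refine Tendsto.const_sub _ ((hω.tendsto_rightSum_exp hT).comp ?_)
    exact tendsto_atTop_mono (fun m => by simp only [id]; nlinarith) tendsto_id
  have hdiff (m : ℕ) := (hR n).sub (hR (n * (m + 1)))
  -- Measurability of the pathwise integral is inherited from the almost sure limit, so no joint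
  -- measurability of the process is needed.
  have hIm : AEStronglyMeasurable
      (fun ω => rightSum (fun t => Y t ω) T n - ∫ t in (0 : ℝ)..T, Y t ω) P :=
    aestronglyMeasurable_of_tendsto_ae atTop (fun m => (hdiff m).aestronglyMeasurable) hlim
  have hIle : eLpNorm (fun ω => rightSum (fun t => Y t ω) T n - ∫ t in (0 : ℝ)..T, Y t ω) 2 P ≤
      ENNReal.ofReal (A * (T / n)) := by
    -- Fatou in `L²`: the bound on coarse minus refined sums does not depend on `m`, so it survives
    -- the limit.
    refine Lp.eLpNorm_le_of_ae_tendsto (Eventually.of_forall fun m => ?_)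
      (fun m => (hdiff m).aestronglyMeasurable) hlim
    refine (eLpNorm_two_le_iff (hdiff m) (by positivity)).2 ?_
    rw [mul_pow, hA2]
    exact hmain hn (by omega)
  have hImem : MemLp (fun ω => rightSum (fun t => Y t ω) T n - ∫ t in (0 : ℝ)..T, Y t ω) 2 P :=
    ⟨hIm, hIle.trans_lt ENNReal.ofReal_lt_top⟩
  have heq : (fun ω => trapezoidalAverage X S₀ T n ω - asianAverage X S₀ T ω) =
      (S₀ * T⁻¹) • ((fun ω => rightSum (fun t => Y t ω) T n - ∫ t in (0 : ℝ)..T, Y t ω) +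
        (T / n / 2) • fun ω => Real.exp (X 0 ω) - Real.exp (X T.toNNReal ω)) := by
    funext ω
    simp only [trapezoidalAverage_eq X S₀ T hn, asianAverage, Pi.smul_apply, Pi.add_apply,
      smul_eq_mul, Y]
    ring
  have hfmem : MemLp (fun ω => trapezoidalAverage X S₀ T n ω - asianAverage X S₀ T ω) 2 P := by
    rw [heq]
    exact (hImem.add (hEmem.const_smul _)).const_smul _
  refine ⟨hfmem, (eLpNorm_two_le_iff hfmem (by positivity)).1 ?_⟩
  rw [heq, eLpNorm_const_smul, Real.enorm_eq_ofReal (by positivity), mul_assoc (S₀ * T⁻¹),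
    ENNReal.ofReal_mul (p := S₀ * T⁻¹) (by positivity)]
  gcongr
  refine (eLpNorm_add_le hIm (hEmem.const_smul _).aestronglyMeasurable one_le_two).trans ?_
  rw [eLpNorm_const_smul, Real.enorm_eq_ofReal (by positivity), add_mul,
    ENNReal.ofReal_add (by positivity) (by positivity)]
  refine add_le_add hIle (le_of_eq ?_)
  rw [← ENNReal.ofReal_toReal hEmem.eLpNorm_ne_top, ← ENNReal.ofReal_mul (by positivity)]
  congr 1
  ring

end Asian

/-! ### Lipschitz payoffs and the main theorem. -/

/-- Subtracting `f 0` gives a Lipschitz function vanishing at zero, which preserves `L^p`; the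
constant returns because the measure is finite. -/
lemma LipschitzWith.memLp_comp {Ω : Type*} [MeasurableSpace Ω] {P : Measure Ω} [IsFiniteMeasure P]
    {f : ℝ → ℝ} {L : ℝ≥0} (hf : LipschitzWith L f) {p : ℝ≥0∞} {U : Ω → ℝ} (hU : MemLp U p P) :
    MemLp (fun ω => f (U ω)) p P := by
  have h : LipschitzWith L fun x => f x - f 0 := by
    simpa using hf.sub (LipschitzWith.const (f 0))
  have h' := (h.comp_memLp (by simp) hU).add (memLp_const (f 0))
  simpa only [Function.comp_def, Pi.add_def, sub_add_cancel] using h'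

theorem mainTheorem5 {Ω : Type*} [MeasurableSpace Ω] (P : Measure Ω) [IsProbabilityMeasure P]
    (X : ℝ≥0 → Ω → ℝ) (m σ : ℝ) (ν : Measure ℝ) (hX : IsLevyProcessWithTriplet X P m σ ν)
    (hν : IntegrableOn (fun z : ℝ => Real.exp (2 * z)) {z : ℝ | 1 < |z|} ν)
    (S₀ T : ℝ) (hS₀ : 0 < S₀) (hT : 0 < T) :
    ∃ C : ℝ,
      -- mean-square error of the trapezoidal approximation, `h = T / n`
      (∀ n : ℕ, 1 ≤ n →
        MemLp (fun ω => trapezoidalAverage X S₀ T n ω - asianAverage X S₀ T ω) 2 P ∧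
        ∫ ω, (trapezoidalAverage X S₀ T n ω - asianAverage X S₀ T ω) ^ 2 ∂P
          ≤ C * (T / n) ^ 2) ∧
      ∀ (payoff : ℝ → ℝ) (L : ℝ≥0), LipschitzWith L payoff →
        -- weak error
        (Integrable (fun ω => payoff (asianAverage X S₀ T ω)) P ∧
          ∀ n : ℕ, 1 ≤ n →
            Integrable (fun ω => payoff (trapezoidalAverage X S₀ T n ω)) P ∧
            |∫ ω, (payoff (trapezoidalAverage X S₀ T n ω) - payoff (asianAverage X S₀ T ω)) ∂P|
              ≤ C * L * (T / n)) ∧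
        -- multilevel variance, with `M ^ ℓ` steps of size `h_ℓ = T / M ^ ℓ` on level `ℓ`
        (∀ M : ℕ, 2 ≤ M → ∀ ℓ : ℕ, 1 ≤ ℓ →
          MemLp (fun ω => payoff (trapezoidalAverage X S₀ T (M ^ ℓ) ω) -
            payoff (trapezoidalAverage X S₀ T (M ^ (ℓ - 1)) ω)) 2 P ∧
          variance (fun ω => payoff (trapezoidalAverage X S₀ T (M ^ ℓ) ω) -
            payoff (trapezoidalAverage X S₀ T (M ^ (ℓ - 1)) ω)) P
              ≤ C * (L : ℝ) ^ 2 * (M : ℝ) ^ 2 * (T / (M : ℝ) ^ ℓ) ^ 2) := by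

  obtain ⟨c, hc⟩ := hX.exists_lintegral_exp_le hν
  have hmem := hX.isLevyProcess.memLp_exp hc
  obtain ⟨D, hD0, hD⟩ := hX.isLevyProcess.exists_trapezoidal_error_bound hc hS₀ hT
  have htrap {n : ℕ} (hn : 1 ≤ n) := memLp_trapezoidalAverage hmem S₀ T hn
  -- The average is the one-step trapezoidal value minus its error, both square integrable.
  have hasian : MemLp (asianAverage X S₀ T) 2 P := by
    have h := (htrap le_rfl).sub (hD 1 le_rfl).1
    simpa only [Pi.sub_def, sub_sub_cancel] using h
  -- The term `4 D²` covers the two quadratic estimates and `D` the weak error, which is linear in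
  -- `D`.
  refine ⟨4 * D ^ 2 + D, fun n hn => ⟨(hD n hn).1, (hD n hn).2.trans ?_⟩,
    fun payoff L hL => ⟨⟨(hL.memLp_comp hasian).integrable one_le_two, fun n hn =>
      ⟨(hL.memLp_comp (htrap hn)).integrable one_le_two, ?_⟩⟩, fun M hM ℓ hℓ => ?_⟩⟩
  · rw [mul_pow]
    gcongr
    nlinarith [sq_nonneg D]
  · have hE := integral_abs_le_of_integral_sq_le (hD n hn).1 (by positivity) (hD n hn).2
    calc |∫ ω, (payoff (trapezoidalAverage X S₀ T n ω) - payoff (asianAverage X S₀ T ω)) ∂P|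
        ≤ ∫ ω, |payoff (trapezoidalAverage X S₀ T n ω) - payoff (asianAverage X S₀ T ω)| ∂P :=
          abs_integral_le_integral_abs
      _ ≤ ∫ ω, L * |trapezoidalAverage X S₀ T n ω - asianAverage X S₀ T ω| ∂P := by
          refine integral_mono (((hL.memLp_comp (htrap hn)).sub
            (hL.memLp_comp hasian)).integrable one_le_two).abs
            (((hD n hn).1.integrable one_le_two).abs.const_mul _) fun ω => ?_
          simpa [Real.dist_eq] using hL.dist_le_mul (trapezoidalAverage X S₀ T n ω)
            (asianAverage X S₀ T ω)
      _ ≤ L * (D * (T / n)) := by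
          rw [integral_const_mul]
          gcongr
      _ ≤ (4 * D ^ 2 + D) * L * (T / n) := by
          have : 0 ≤ D ^ 2 * (L * (T / n)) := by positivity
          linarith
  · have hM0 : 0 < M := by omega
    have hM1 : (1 : ℝ) ≤ M := by exact_mod_cast hM0
    have hn₁ : 1 ≤ M ^ ℓ := Nat.one_le_pow _ _ hM0
    have hn₀ : 1 ≤ M ^ (ℓ - 1) := Nat.one_le_pow _ _ hM0
    have hmemdiff := (hL.memLp_comp (htrap hn₁)).sub (hL.memLp_comp (htrap hn₀))
    refine ⟨hmemdiff, (variance_le_expectation_sq hmemdiff.aestronglyMeasurable).trans ?_⟩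
    -- The coarser step is `M` times the finer one, which is the origin of the factor `M²` in the
    -- variance.
    have hstep : T / ((M ^ (ℓ - 1) : ℕ) : ℝ) = M * (T / (M : ℝ) ^ ℓ) := by
      obtain ⟨k, rfl⟩ := Nat.exists_eq_add_of_le' hℓ
      push_cast
      rw [pow_succ]
      field_simp
    have h₁ := (hD _ hn₁).2
    have h₀ := (hD _ hn₀).2
    rw [hstep] at h₀
    push_cast at h₁
    have hi₁ := (hD _ hn₁).1.integrable_sq
    have hi₀ := (hD _ hn₀).1.integrable_sq
    set h := T / (M : ℝ) ^ ℓ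
    calc ∫ ω, (payoff (trapezoidalAverage X S₀ T (M ^ ℓ) ω) -
            payoff (trapezoidalAverage X S₀ T (M ^ (ℓ - 1)) ω)) ^ 2 ∂P
        ≤ ∫ ω, (L : ℝ) ^ 2 * (2 *
            ((trapezoidalAverage X S₀ T (M ^ ℓ) ω - asianAverage X S₀ T ω) ^ 2 +
            (trapezoidalAverage X S₀ T (M ^ (ℓ - 1)) ω - asianAverage X S₀ T ω) ^ 2)) ∂P := by
          refine integral_mono hmemdiff.integrable_sq
            (((hi₁.add hi₀).const_mul 2).const_mul _) fun ω => ?_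
          have hl := hL.dist_le_mul (trapezoidalAverage X S₀ T (M ^ ℓ) ω)
            (trapezoidalAverage X S₀ T (M ^ (ℓ - 1)) ω)
          rw [Real.dist_eq, Real.dist_eq] at hl
          have hl2 := pow_le_pow_left₀ (abs_nonneg _) hl 2
          rw [mul_pow, sq_abs, sq_abs] at hl2
          refine hl2.trans (mul_le_mul_of_nonneg_left ?_ (sq_nonneg _))
          -- With `a` and `b` the errors on the two levels, this is `(a - b)² ≤ 2 (a² + b²)`.
          nlinarith [sq_nonneg ((trapezoidalAverage X S₀ T (M ^ ℓ) ω - asianAverage X S₀ T ω) +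
            (trapezoidalAverage X S₀ T (M ^ (ℓ - 1)) ω - asianAverage X S₀ T ω))]
      _ ≤ (L : ℝ) ^ 2 * (2 * ((D * h) ^ 2 + (D * (M * h)) ^ 2)) := by
          rw [integral_const_mul, integral_const_mul, integral_add hi₁ hi₀]
          gcongr
      _ ≤ (L : ℝ) ^ 2 * (2 * ((D * (M * h)) ^ 2 + (D * (M * h)) ^ 2)) := by
          have : 0 ≤ h := by positivity
          gcongr
          exact le_mul_of_one_le_left this hM1
      _ = 4 * D ^ 2 * (L : ℝ) ^ 2 * (M : ℝ) ^ 2 * h ^ 2 := by ring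
      _ ≤ (4 * D ^ 2 + D) * (L : ℝ) ^ 2 * (M : ℝ) ^ 2 * h ^ 2 := by
          gcongr
          linarith
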